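/- Let $S$ be a finite set of qubits, partitioned in two ways, $S=A\sqcup B=C\sqcup D$, so that $\mathcal H_S=\mathcal H_A\otimes\mathcal H_B=\mathcal H_C\otimes\mathcal H_D$, and let $\overline B$ be a copy of $B$. Let $U$ be a Clifford unitary on $\mathcal H_S$: for every Pauli operator $P$ (a tensor product of the single-qubit matrices $I,X,Y,Z$), $UPU^\dagger$ is a Pauli operator up to a phase. Put $d_B=2^{|B|}$, $|\mathrm{EPR}\rangle_{B\overline B}=d_B^{-1/2}\sum_{j}|j\rangle_B\otimes|j\rangle_{\overline B}$, let $\Gamma:\mathcal H_A\to\mathcal H_C\otimes\mathcal H_D\otimes\mathcal H_{\overline B}$ be the isometry $$\Gamma|\psi\rangle=(U\otimes I_{\overline B})\big(|\psi\rangle_A\otimes|\mathrm{EPR}\rangle_{B\overline B}\big),$$ and let $\mathcal N(\sigma)=\mathrm{Tr}_C(\Gamma\sigma\Gamma^\dagger)$, a map from operators on $\mathcal H_A$ to operators on $\mathcal H_D\otimes\mathcal H_{\overline B}$. For a Pauli operator $P_A$ on $A$, taken up to phase, write $$U(P_A\otimes I_B)U^\dagger=e^{i\theta}\,\Lambda_C(P_A)\otimes\Lambda_D(P_A)$$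 with Pauli operators $\Lambda_C(P_A)$ on $C$ and $\Lambda_D(P_A)$ on $D$; these are unique up to phase. This defines the forward time-evolution map $\Lambda_D:\mathrm{Pauli}_A\to\mathrm{Pauli}_D$ between Pauli operators up to phase. Then the following are equivalent: 1. (Perfect recovery.) There is a quantum channel (completely positive trace-preserving linear map) $\mathcal R$ from operators on $\mathcal H_D\otimes\mathcal H_{\overline B}$ to operators on $\mathcal H_A$ such that $\mathcal R(\mathcal N(\sigma))=\sigma$ for every density operator $\sigma$ on $\mathcal H_A$. 2. $\Lambda_D$ is injective. -/

import Mathlib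

open scoped Matrix Kronecker ComplexOrder

noncomputable section

/-- Labels of the computational basis of a register whose qubits are labelled by `S`;
the Hilbert space of the register has dimension `2 ^ |S|`. -/
abbrev Bits (S : Type*) : Type _ := S → Fin 2

/-- Operators (in the computational basis) on the register with qubit set `S`. -/
abbrev Op (S : Type*) : Type _ := Matrix (Bits S) (Bits S) ℂ

/-- Labels of the four single-qubit Pauli operators. -/
inductive Pauli : Type
  | I | X | Y | Z

/-- The single-qubit Pauli matrices. -/
def Pauli.mat : Pauli → Matrix (Fin 2) (Fin 2) ℂ
  | .I => !![1, 0; 0, 1]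
  | .X => !![0, 1; 1, 0]
  | .Y => !![0, -Complex.I; Complex.I, 0]
  | .Z => !![1, 0; 0, -1]

/-- The Pauli operators on the qubits `S`, up to phase: one single-qubit Pauli for each qubit. -/
abbrev PauliString (S : Type*) : Type _ := S → Pauli

/-- The tensor product of the single-qubit Pauli matrices of a Pauli string. -/
def PauliString.op {S : Type*} [Fintype S] (p : PauliString S) : Op S :=
  Matrix.of fun x y => ∏ s, (p s).mat (x s) (y s)

/-- `PhaseEq M N`: equality of `M` and `N` up to a `U(1)` phase factor. -/
def PhaseEq {m n : Type*} (M N : Matrix m n ℂ) : Prop :=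
  ∃ c : ℂ, ‖c‖ = 1 ∧ M = c • N

/-- A Clifford operator: a unitary that conjugates every Pauli operator to a Pauli operator,
up to a phase. -/
def IsClifford {S : Type*} [Fintype S] [DecidableEq S] (U : Op S) : Prop :=
  U ∈ Matrix.unitaryGroup (Bits S) ℂ ∧
    ∀ p : PauliString S, ∃ q : PauliString S, PhaseEq (U * p.op * Uᴴ) q.op

/-- A partition `e : K ⊕ L ≃ S` of the qubits `S` into two registers `K` and `L` splits each
basis label of `S` into a pair. -/
def splitBits {K L S : Type*} (e : K ⊕ L ≃ S) : Bits S ≃ Bits K × Bits L :=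
  (Equiv.arrowCongr e.symm (Equiv.refl (Fin 2))).trans (Equiv.sumArrowEquivProdArrow K L (Fin 2))

/-- The Pauli string `p ⊗ q` on `S = K ⊔ L`. -/
def PauliString.tensor {K L S : Type*} (e : K ⊕ L ≃ S) (p : PauliString K) (q : PauliString L) :
    PauliString S :=
  fun s => Sum.elim p q (e.symm s)

/-- The identity Pauli string. -/
def PauliString.id (S : Type*) : PauliString S := fun _ => Pauli.I

theorem PauliString.op_id (S : Type*) [Fintype S] [DecidableEq S] :
    (PauliString.id S).op = 1 := by
  have h : Pauli.I.mat = 1 := by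
    ext i j; fin_cases i <;> fin_cases j <;> simp [Pauli.mat]
  ext x y
  simp only [PauliString.op, PauliString.id, h, Matrix.of_apply, Matrix.one_apply]
  by_cases hxy : x = y
  · simp [hxy]
  · obtain ⟨s, hs⟩ := Function.ne_iff.1 hxy
    rw [if_neg hxy]
    exact Finset.prod_eq_zero (Finset.mem_univ s) (if_neg hs)

theorem PauliString.op_tensor {K L S : Type*} [Fintype K] [Fintype L] [Fintype S]
    (e : K ⊕ L ≃ S) (p : PauliString K) (q : PauliString L) :
    Matrix.reindex (splitBits e) (splitBits e) (PauliString.tensor e p q).op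
      = p.op ⊗ₖ q.op := by
  ext ⟨x₁, x₂⟩ ⟨y₁, y₂⟩
  simp only [Matrix.reindex_apply, Matrix.submatrix_apply, PauliString.op, Matrix.of_apply,
    Matrix.kroneckerMap_apply]
  rw [← Equiv.prod_comp e, Fintype.prod_sum_type]
  simp [PauliString.tensor, splitBits, Equiv.sumArrowEquivProdArrow]

/-- Distinct Pauli strings are not proportional, so the string of a Pauli operator
is determined by the operator up to phase. -/
theorem PauliString.eq_of_phaseEq {S : Type*} [Fintype S] [DecidableEq S] {M : Op S}
    {p q : PauliString S} (hp : PhaseEq M p.op) (hq : PhaseEq M q.op) : p = q := by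
  have key : ∀ a b : PauliString S,
      (a.op * b.op).trace = ∏ s, ((a s).mat * (b s).mat).trace := by
    intro a b
    simp only [Matrix.trace, Matrix.diag, Matrix.mul_apply, PauliString.op, Matrix.of_apply,
      ← Finset.prod_mul_distrib]
    rw [Fintype.prod_sum]
    refine Finset.sum_congr rfl fun x _ => ?_
    rw [Fintype.prod_sum]
  have hne : ∀ a b : Pauli, a ≠ b → (a.mat * b.mat).trace = 0 := by
    intro a b h
    cases a <;> cases b <;> first | exact absurd rfl h | simp [Pauli.mat, Matrix.trace_fin_two]
  have hself : ∀ a : Pauli, (a.mat * a.mat).trace = 2 := by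
    intro a
    cases a <;> simp [Pauli.mat, Matrix.trace_fin_two] <;> norm_num
  by_contra h
  obtain ⟨s, hs⟩ := Function.ne_iff.1 h
  obtain ⟨c, hc, h1⟩ := hp
  obtain ⟨c', -, h2⟩ := hq
  have h0 : (p.op * q.op).trace = 0 := by
    rw [key]; exact Finset.prod_eq_zero (Finset.mem_univ s) (hne _ _ hs)
  have h3 : (p.op * p.op).trace ≠ 0 := by
    rw [key]; exact Finset.prod_ne_zero_iff.2 fun i _ => by rw [hself]; norm_num
  have h4 : c * (p.op * p.op).trace = c' * (p.op * q.op).trace := by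
    have := congrArg (fun N => (p.op * N).trace) (h1.symm.trans h2)
    simpa using this
  rw [h0, mul_zero] at h4
  have hc0 : c ≠ 0 := by rintro rfl; simp at hc
  exact (mul_ne_zero hc0 h3) h4

/-- The Pauli string of `U p U†`, for a Clifford `U`. -/
def evolve {S : Type*} [Fintype S] [DecidableEq S] {U : Op S} (hU : IsClifford U)
    (p : PauliString S) : PauliString S :=
  (hU.2 p).choose

theorem evolve_spec {S : Type*} [Fintype S] [DecidableEq S] {U : Op S} (hU : IsClifford U)
    (p : PauliString S) : PhaseEq (U * p.op * Uᴴ) (evolve hU p).op :=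
  (hU.2 p).choose_spec

section ForwardMap

variable {S A B C D : Type*} [Fintype S] [DecidableEq S]

/-- The `C`-part of the time-evolved Pauli operator `U (p ⊗ I_B) U†`. -/
def forwardMapC (eAB : A ⊕ B ≃ S) (eCD : C ⊕ D ≃ S) {U : Op S} (hU : IsClifford U)
    (p : PauliString A) : PauliString C :=
  fun c => evolve hU (PauliString.tensor eAB p (PauliString.id B)) (eCD (Sum.inl c))

/-- The forward time-evolution map `Λ_D`: the `D`-part of the time-evolved Pauli
operator `U (p ⊗ I_B) U†`. -/
def forwardMapD (eAB : A ⊕ B ≃ S) (eCD : C ⊕ D ≃ S) {U : Op S} (hU : IsClifford U)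
    (p : PauliString A) : PauliString D :=
  fun d => evolve hU (PauliString.tensor eAB p (PauliString.id B)) (eCD (Sum.inr d))

/-- `U (p ⊗ I_B) U†` equals `Λ_C(p) ⊗ Λ_D(p)` up to phase. -/
theorem forwardMap_spec [Fintype A] [Fintype B] [Fintype C] [Fintype D]
    [DecidableEq A] [DecidableEq B] (eAB : A ⊕ B ≃ S) (eCD : C ⊕ D ≃ S) {U : Op S} (hU : IsClifford U) (p : PauliString A) :
    PhaseEq
      (Matrix.reindex (splitBits eCD) (splitBits eAB) U * (p.op ⊗ₖ (1 : Op B)) *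
        (Matrix.reindex (splitBits eCD) (splitBits eAB) U)ᴴ)
      ((forwardMapC eAB eCD hU p).op ⊗ₖ (forwardMapD eAB eCD hU p).op) := by
  obtain ⟨c, hc, h⟩ := evolve_spec hU (PauliString.tensor eAB p (PauliString.id B))
  refine ⟨c, hc, ?_⟩
  have h1 : PauliString.tensor eCD (forwardMapC eAB eCD hU p) (forwardMapD eAB eCD hU p)
      = evolve hU (PauliString.tensor eAB p (PauliString.id B)) := by
    funext s
    obtain ⟨t, rfl⟩ := eCD.surjective s
    rcases t with t | t <;> simp [PauliString.tensor, forwardMapC, forwardMapD]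
  rw [← PauliString.op_tensor eCD, h1, ← PauliString.op_id, ← PauliString.op_tensor eAB]
  have h2 := congrArg (Matrix.reindex (splitBits eCD) (splitBits eCD)) h
  refine Eq.trans ?_ (h2.trans rfl)
  simp [Matrix.reindex_apply, Matrix.submatrix_mul_equiv, Matrix.conjTranspose_submatrix]

end ForwardMap

/-- Amplitudes of `|EPR⟩ = 2^{-n/2} ∑_j |j⟩ ⊗ |j⟩` on two copies of the register `B`. -/
def epr (B : Type*) [Fintype B] [DecidableEq B] (x : Bits B × Bits B) : ℂ :=
  if x.1 = x.2 then ((1 / Real.sqrt (2 ^ Fintype.card B) : ℝ) : ℂ) else 0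

section HaydenPreskill

variable {S A B C D : Type*} [Fintype A] [Fintype B] [Fintype C] [Fintype D]
  [DecidableEq A] [DecidableEq B] [DecidableEq C] [DecidableEq D]

/-- The linear map `ψ ↦ ψ ⊗ |EPR⟩_{B B̄}` from `A` to `A B B̄`. -/
def attachEPR (A B : Type*) [Fintype A] [Fintype B] [DecidableEq A] [DecidableEq B] :
    Matrix ((Bits A × Bits B) × Bits B) (Bits A) ℂ :=
  Matrix.of fun x a => if x.1.1 = a then epr B (x.1.2, x.2) else 0

/-- The encoding isometry `Γ ψ = (U_{AB} ⊗ I_B̄) (ψ ⊗ |EPR⟩_{B B̄})` from `A` to `C D B̄`. -/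
def encoder (eAB : A ⊕ B ≃ S) (eCD : C ⊕ D ≃ S) (U : Op S) :
    Matrix ((Bits C × Bits D) × Bits B) (Bits A) ℂ :=
  (Matrix.reindex (splitBits eCD) (splitBits eAB) U ⊗ₖ (1 : Op B)) * attachEPR A B

/-- The noisy channel `N(σ) = Tr_C (Γ σ Γ†)` from `A` to `D B̄`. -/
def noisyChannel (eAB : A ⊕ B ≃ S) (eCD : C ⊕ D ≃ S) (U : Op S) (σ : Op A) :
    Matrix (Bits D × Bits B) (Bits D × Bits B) ℂ :=
  Matrix.of fun x y => ∑ c : Bits C,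
    (encoder eAB eCD U * σ * (encoder eAB eCD U)ᴴ) ((c, x.1), x.2) ((c, y.1), y.2)

end HaydenPreskill

/-- The map `id_k ⊗ Φ` on operators, written blockwise. -/
def ampliation {m n : Type*} (k : ℕ) (Φ : Matrix m m ℂ →ₗ[ℂ] Matrix n n ℂ)
    (M : Matrix (Fin k × m) (Fin k × m) ℂ) : Matrix (Fin k × n) (Fin k × n) ℂ :=
  Matrix.of fun x y => Φ (Matrix.of fun a b => M (x.1, a) (y.1, b)) x.2 y.2

/-- A quantum channel: a completely positive, trace-preserving linear map. -/
structure IsQuantumChannel {m n : Type*} [Fintype m] [Fintype n]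
    (Φ : Matrix m m ℂ →ₗ[ℂ] Matrix n n ℂ) : Prop where
  completelyPositive : ∀ (k : ℕ) (M : Matrix (Fin k × m) (Fin k × m) ℂ),
    M.PosSemidef → (ampliation k Φ M).PosSemidef
  tracePreserving : ∀ M : Matrix m m ℂ, (Φ M).trace = M.trace

/-- Density operators. -/
def IsState {m : Type*} [Fintype m] (σ : Matrix m m ℂ) : Prop :=
  σ.PosSemidef ∧ σ.trace = 1

/-- Perfect recovery in the Hayden-Preskill problem: one recovery channel from `D B̄` to `A`
restores every input state on `A`. -/
def PerfectRecovery {S A B C D : Type*} [Fintype A] [Fintype B] [Fintype C] [Fintype D]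
    [DecidableEq A] [DecidableEq B] [DecidableEq C] [DecidableEq D]
    (eAB : A ⊕ B ≃ S) (eCD : C ⊕ D ≃ S) (U : Op S) : Prop :=
  ∃ Rec : Matrix (Bits D × Bits B) (Bits D × Bits B) ℂ →ₗ[ℂ] Op A,
    IsQuantumChannel Rec ∧
      ∀ σ : Op A, IsState σ → Rec (noisyChannel eAB eCD U σ) = σ

end

/-! Recovery forces injectivity: since `U` carries `P ⊗ I_B` to `Λ_C(P) ⊗ Λ_D(P)` and the unitary
`Λ_C(P)` disappears under `Tr_C`, conjugating the input by `P` conjugates `N(σ)` by `Λ_D(P) ⊗ 1`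
(`noisyChannel_pauli_conj`). If `Λ_D(P) = Λ_D(Q)`, the recovered states `PσP` and `QσQ` agree for
every `σ`, so `P = Q`.

Injectivity gives recovery through the Knill-Laflamme condition for erasure of `C`. A nonidentity
Pauli on `C` pulls back under `U` to some `p ⊗ q`; injectivity rules out `q = I`, and the EPR pair
then contributes `Tr q / d_B = 0` (`conjTranspose_encoder_mul_pauli`). By Pauli expansion `Γ† E_C Γ
= Tr(E) / d_C`. Hence the operators `√d_C ⟨c|Γ` are isometries with orthogonal ranges, reversed by
one channel (`exists_recovery_of_orthogonal_isometries`). -/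

noncomputable section

/-! ### Pauli strings as an operator basis -/

section PauliAlgebra

theorem Pauli.mat_mul_self (a : Pauli) : a.mat * a.mat = 1 := by
  ext i j
  cases a <;> fin_cases i <;> fin_cases j <;> simp [Pauli.mat, Matrix.mul_apply]

theorem Pauli.star_mat_apply (a : Pauli) (i j : Fin 2) : star (a.mat i j) = a.mat j i := by
  cases a <;> fin_cases i <;> fin_cases j <;> simp [Pauli.mat]

theorem Pauli.trace_mat_of_ne {a : Pauli} (h : a ≠ Pauli.I) : a.mat.trace = 0 := by
  cases a <;> first | exact absurd rfl h | simp [Pauli.mat, Matrix.trace_fin_two]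

instance : Fintype Pauli where
  elems := ⟨[Pauli.I, Pauli.X, Pauli.Y, Pauli.Z], by simp⟩
  complete a := by cases a <;> simp

theorem Pauli.sum_univ {M : Type*} [AddCommMonoid M] (f : Pauli → M) :
    ∑ a, f a = f Pauli.I + (f Pauli.X + (f Pauli.Y + f Pauli.Z)) := by
  simp [Finset.univ, Fintype.elems, Finset.sum]

theorem Pauli.completeness (i j k l : Fin 2) :
    ∑ a : Pauli, a.mat i j * a.mat k l = if i = l ∧ j = k then 2 else 0 := by
  rw [Pauli.sum_univ]
  fin_cases i <;> fin_cases j <;> fin_cases k <;> fin_cases l <;> simp [Pauli.mat] <;> norm_num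

variable {S : Type*} [Fintype S]

theorem PauliString.conjTranspose_op (p : PauliString S) : p.opᴴ = p.op := by
  ext x y
  simp only [PauliString.op, Matrix.conjTranspose_apply, Matrix.of_apply, star_prod,
    Pauli.star_mat_apply]

theorem PauliString.trace_op [DecidableEq S] (p : PauliString S) :
    p.op.trace = ∏ s, (p s).mat.trace := by
  simp only [Matrix.trace, Matrix.diag, PauliString.op, Matrix.of_apply]
  rw [Fintype.prod_sum]

theorem PauliString.trace_op_of_ne [DecidableEq S] {p : PauliString S} (h : p ≠ PauliString.id S) :
    p.op.trace = 0 := by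
  obtain ⟨s, hs⟩ := Function.ne_iff.1 h
  rw [PauliString.trace_op]
  exact Finset.prod_eq_zero (Finset.mem_univ s) (Pauli.trace_mat_of_ne hs)

variable [DecidableEq S]

theorem PauliString.op_mul_self (p : PauliString S) : p.op * p.op = 1 := by
  rw [← PauliString.op_id]
  ext x y
  simp only [Matrix.mul_apply, PauliString.op, Matrix.of_apply, ← Finset.prod_mul_distrib]
  rw [← Fintype.prod_sum (fun s i => (p s).mat (x s) i * (p s).mat i (y s))]
  refine Finset.prod_congr rfl fun s _ => ?_
  rw [← Matrix.mul_apply, Pauli.mat_mul_self]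
  generalize x s = i
  generalize y s = j
  fin_cases i <;> fin_cases j <;> simp [PauliString.id, Pauli.mat]

/-- The sum of `P ⊗ P` over all Pauli strings is `2 ^ |S|` times the swap, and it factors qubit by
qubit. -/
theorem PauliString.completeness (x y z w : Bits S) :
    ∑ p : PauliString S, p.op x y * p.op z w =
      if x = w ∧ y = z then (2 : ℂ) ^ Fintype.card S else 0 := by
  simp only [PauliString.op, Matrix.of_apply, ← Finset.prod_mul_distrib]
  rw [← Fintype.prod_sum (fun s (a : Pauli) => a.mat (x s) (y s) * a.mat (z s) (w s))]
  simp only [Pauli.completeness]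
  split_ifs with h
  · simp [h.1, h.2]
  · have : ∃ s, ¬ (x s = w s ∧ y s = z s) := by
      by_contra! hc
      exact h ⟨funext fun s => (hc s).1, funext fun s => (hc s).2⟩
    obtain ⟨s, hs⟩ := this
    exact Finset.prod_eq_zero (Finset.mem_univ s) (if_neg hs)

/-- Pauli expansion of an operator. -/
theorem PauliString.two_pow_smul_eq_sum (M : Op S) :
    (2 : ℂ) ^ Fintype.card S • M = ∑ p : PauliString S, (p.op * M).trace • p.op := by
  ext x y
  simp only [Matrix.sum_apply, Matrix.smul_apply, smul_eq_mul, Matrix.trace, Matrix.diag,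
    Matrix.mul_apply, Finset.sum_mul]
  rw [Finset.sum_comm]
  simp_rw [Finset.sum_comm (s := (Finset.univ : Finset (PauliString S)))]
  have h (z w : Bits S) : ∑ p : PauliString S, p.op z w * M w z * p.op x y =
      if z = y ∧ w = x then (2 : ℂ) ^ Fintype.card S * M w z else 0 := by
    simp_rw [mul_right_comm _ (M w z), ← Finset.sum_mul, PauliString.completeness]
    split_ifs <;> simp
  simp_rw [h, ite_and]
  simp

/-- A linear map that kills every nonidentity Pauli operator is a multiple of the trace. -/
theorem LinearMap.eq_trace_smul_of_pauli {E : Type*} [AddCommGroup E] [Module ℂ E]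
    (f : Op S →ₗ[ℂ] E) (hf : ∀ p : PauliString S, p ≠ PauliString.id S → f p.op = 0) (M : Op S) :
    (2 : ℂ) ^ Fintype.card S • f M = M.trace • f 1 := by
  rw [← map_smul, PauliString.two_pow_smul_eq_sum, map_sum,
    Finset.sum_eq_single (PauliString.id S)]
  · rw [map_smul, PauliString.op_id, one_mul]
  · intro p _ hp
    rw [map_smul, hf p hp, smul_zero]
  · simp

theorem PauliString.eq_of_conj_eq {p q : PauliString S}
    (h : ∀ X : Op S, p.op * X * p.op = q.op * X * q.op) : p = q := by
  have hcomm : ∀ X : Op S, Commute X (q.op * p.op) := by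
    intro X
    have := congrArg (fun M => q.op * M * p.op) (h X)
    simp only [mul_assoc, PauliString.op_mul_self, mul_one] at this
    rw [← mul_assoc q.op q.op, PauliString.op_mul_self, one_mul] at this
    simpa only [Commute, SemiconjBy, mul_assoc] using this.symm
  -- Commuting with all matrix units makes `q.op * p.op` scalar; since both strings square to 1,
  -- that scalar does too, so it is a phase.
  obtain ⟨c, hc⟩ := Matrix.mem_range_scalar_iff_commute_single'.2 fun i j => hcomm (.single i j 1)
  have hp : p.op = c • q.op := by
    have := congrArg (fun M => q.op * M) hc
    simp only [← mul_assoc, PauliString.op_mul_self, one_mul] at this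
    rw [← this, Matrix.scalar_apply, ← Matrix.smul_one_eq_diagonal, mul_smul_comm, mul_one]
  have hcc : c * c = 1 := by
    have h1 := PauliString.op_mul_self p
    rw [hp, smul_mul_smul_comm, PauliString.op_mul_self] at h1
    simpa using congrFun (congrFun h1 0) 0
  have hn : ‖c‖ = 1 := by
    have := congrArg norm hcc
    rw [norm_mul, norm_one] at this
    nlinarith [norm_nonneg c]
  exact PauliString.eq_of_phaseEq ⟨1, by simp, by simp⟩ ⟨c, hn, hp⟩

end PauliAlgebra

/-! ### Clifford evolution of Pauli strings -/

section Evolution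

variable {S : Type*} [Fintype S] [DecidableEq S] {U : Op S} (hU : IsClifford U)

theorem evolve_id : evolve hU (PauliString.id S) = PauliString.id S := by
  refine PauliString.eq_of_phaseEq (evolve_spec hU _) ⟨1, by simp, ?_⟩
  rw [PauliString.op_id, mul_one, one_smul]
  exact Matrix.mem_unitaryGroup_iff.1 hU.1

/-- Conjugation by `U` is invertible and Pauli strings are finite in number, so surjectivity is
free; it lets Paulis on `C` be pulled back without showing that `U†` is Clifford. -/
theorem evolve_bijective : Function.Bijective (evolve hU) := by
  rw [← Finite.injective_iff_bijective]
  intro p q hpq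
  obtain ⟨c, hc, h⟩ := evolve_spec hU p
  obtain ⟨c', hc', h'⟩ := evolve_spec hU q
  rw [hpq] at h
  have hUU : Uᴴ * U = 1 := Matrix.mem_unitaryGroup_iff'.1 hU.1
  have back (P : Op S) : Uᴴ * (U * P * Uᴴ) * U = P := by
    simp only [mul_assoc, hUU, mul_one]
    rw [← mul_assoc, hUU, one_mul]
  have e1 := congrArg (fun M => Uᴴ * M * U) h
  have e2 := congrArg (fun M => Uᴴ * M * U) h'
  simp only [back] at e1 e2
  simp only [mul_smul_comm, smul_mul_assoc] at e1 e2
  have hc0 : c' ≠ 0 := by rintro rfl; simp at hc'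
  refine PauliString.eq_of_phaseEq (M := p.op) ⟨1, by simp, by simp⟩ ⟨c * c'⁻¹, by simp [hc, hc'], ?_⟩
  rw [e1, e2, smul_smul, inv_mul_cancel_right₀ hc0]

end Evolution

/-! ### Kraus maps, recovery, and testing on states -/

section Channels

variable {m n ι : Type*} [Fintype m] [Fintype ι]

/-- The completely positive map with Kraus operators `L i`. -/
def krausMap (L : ι → Matrix n m ℂ) : Matrix m m ℂ →ₗ[ℂ] Matrix n n ℂ where
  toFun X := ∑ i, L i * X * (L i)ᴴ
  map_add' X Y := by simp [Matrix.mul_add, Matrix.add_mul, Finset.sum_add_distrib]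
  map_smul' c X := by simp [Finset.smul_sum]

theorem krausMap_apply (L : ι → Matrix n m ℂ) (X : Matrix m m ℂ) :
    krausMap L X = ∑ i, L i * X * (L i)ᴴ := rfl

theorem ampliation_krausMap (k : ℕ) (L : ι → Matrix n m ℂ)
    (M : Matrix (Fin k × m) (Fin k × m) ℂ) :
    ampliation k (krausMap L) M =
      ∑ i, ((1 : Matrix (Fin k) (Fin k) ℂ) ⊗ₖ L i) * M *
        ((1 : Matrix (Fin k) (Fin k) ℂ) ⊗ₖ L i)ᴴ := by
  ext ⟨a, x⟩ ⟨b, y⟩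
  simp [ampliation, krausMap_apply, Matrix.sum_apply, Matrix.mul_apply, Fintype.sum_prod_type,
    Matrix.one_apply, apply_ite, ite_mul, Finset.sum_ite_irrel]

theorem isQuantumChannel_krausMap [Fintype n] [DecidableEq m] (L : ι → Matrix n m ℂ)
    (hL : ∑ i, (L i)ᴴ * L i = 1) : IsQuantumChannel (krausMap L) where
  completelyPositive k M hM := by
    rw [ampliation_krausMap]
    exact Matrix.posSemidef_sum _ fun i _ => hM.mul_mul_conjTranspose_same _
  tracePreserving M := by
    rw [krausMap_apply, Matrix.trace_sum]
    simp_rw [Matrix.trace_mul_comm _ (_ᴴ), ← Matrix.mul_assoc]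
    rw [← Matrix.trace_sum, ← Matrix.sum_mul, hL, Matrix.one_mul]

/-- Isometries with pairwise orthogonal ranges are reversed by a single quantum channel. -/
theorem exists_recovery_of_orthogonal_isometries [Fintype n] [DecidableEq m] [DecidableEq n]
    [DecidableEq ι] [Nonempty n] (K : ι → Matrix m n ℂ) (hK : ∀ i j, (K i)ᴴ * K j = if i = j then 1 else 0) :
    ∃ R : Matrix m m ℂ →ₗ[ℂ] Matrix n n ℂ, IsQuantumChannel R ∧
      ∀ i σ, R (K i * σ * (K i)ᴴ) = σ := by
  obtain ⟨a⟩ := ‹Nonempty n›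
  -- Projection onto the complement of all the ranges.
  set Q : Matrix m m ℂ := 1 - ∑ i, K i * (K i)ᴴ with hQ
  have hQK (i : ι) : Q * K i = 0 := by
    have h (j : ι) : K j * (K j)ᴴ * K i = if j = i then K i else 0 := by
      rw [Matrix.mul_assoc, hK]
      split_ifs with hji <;> simp [hji]
    simp [hQ, Matrix.sub_mul, Matrix.sum_mul, h]
  have hQH : Qᴴ = Q := by
    simp [hQ, Matrix.conjTranspose_sum]
  have hQQ : Q * Q = Q := by
    conv_lhs => rw [hQ, Matrix.mul_sub, Matrix.mul_one, Matrix.mul_sum]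
    simp [← Matrix.mul_assoc, ← hQ, hQK]
  -- The operators `|a⟩⟨x| Q` send the complement to the fixed basis state `a`, which restores trace
  -- preservation.
  let L : ι ⊕ m → Matrix n m ℂ := Sum.elim (fun i => (K i)ᴴ) (fun x => Matrix.single a x (1 : ℂ) * Q)
  refine ⟨krausMap L, isQuantumChannel_krausMap L ?_, fun i σ => ?_⟩
  · have h (x : m) : (Matrix.single a x (1 : ℂ) * Q)ᴴ * (Matrix.single a x (1 : ℂ) * Q) =
        Q * Matrix.single x x 1 * Q := by
      rw [Matrix.conjTranspose_mul, hQH, Matrix.conjTranspose_single, Matrix.mul_assoc,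
        ← Matrix.mul_assoc (Matrix.single x a _)]
      simp [Matrix.mul_assoc]
    have hone : ∑ x : m, Matrix.single x x (1 : ℂ) = 1 := by
      ext x y
      simp [Matrix.sum_apply, Matrix.single_apply, Matrix.one_apply, ite_and]
    rw [Fintype.sum_sum_type]
    simp only [L, Sum.elim_inl, Sum.elim_inr, Matrix.conjTranspose_conjTranspose, h]
    rw [← Matrix.sum_mul, ← Matrix.mul_sum, hone, Matrix.mul_one, hQQ, hQ]
    abel
  · have hinr (x : m) : L (Sum.inr x) * (K i * σ * (K i)ᴴ) = 0 := by
      simp only [L, Sum.elim_inr]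
      rw [Matrix.mul_assoc (Matrix.single a x 1), ← Matrix.mul_assoc Q, ← Matrix.mul_assoc Q, hQK]
      simp
    have hinl (j : ι) : L (Sum.inl j) * (K i * σ * (K i)ᴴ) * (L (Sum.inl j))ᴴ =
        if j = i then σ else 0 := by
      simp only [L, Sum.elim_inl, Matrix.conjTranspose_conjTranspose]
      rw [show (K j)ᴴ * (K i * σ * (K i)ᴴ) * K j = ((K j)ᴴ * K i) * σ * ((K i)ᴴ * K j) by
        simp only [Matrix.mul_assoc], hK, hK]
      by_cases hji : j = i
      · simp [hji]
      · simp [hji]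
    rw [krausMap_apply, Fintype.sum_sum_type]
    simp [hinr, hinl]

/-- Linear maps that agree on states are equal. -/
theorem LinearMap.ext_isState [DecidableEq m] {E : Type*} [AddCommGroup E] [Module ℂ E]
    {f g : Matrix m m ℂ →ₗ[ℂ] E} (h : ∀ σ, IsState σ → f σ = g σ) : f = g := by
  have hpos : ∀ M : Matrix m m ℂ, M.PosSemidef → f M = g M := by
    intro M hM
    by_cases ht : M.trace = 0
    · rw [hM.trace_eq_zero_iff.1 ht, map_zero, map_zero]
    · have := h ((M.trace)⁻¹ • M)
        ⟨hM.smul (inv_nonneg.2 hM.trace_nonneg), by simp [ht]⟩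
      rw [map_smul, map_smul] at this
      exact smul_right_injective E (inv_ne_zero ht) this
  have hsq (X : Matrix m m ℂ) := hpos _ (Matrix.posSemidef_self_mul_conjTranspose X)
  refine LinearMap.ext fun X => ?_
  -- Polarization of the product of `X` with `1`: four positive operators weighted by powers of `I`.
  have key : X = (1 / 4 : ℂ) • ((X + 1) * (X + 1)ᴴ - (X - 1) * (X - 1)ᴴ +
      Complex.I • ((X + Complex.I • 1) * (X + Complex.I • 1)ᴴ) -
      Complex.I • ((X - Complex.I • 1) * (X - Complex.I • 1)ᴴ)) := by
    simp only [Matrix.conjTranspose_add, Matrix.conjTranspose_sub, Matrix.conjTranspose_one,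
      Matrix.conjTranspose_smul, Matrix.add_mul, Matrix.mul_add, Matrix.sub_mul, Matrix.mul_sub,
      Matrix.mul_one, Matrix.one_mul, Matrix.smul_mul, Matrix.mul_smul, Complex.star_def,
      Complex.conj_I]
    match_scalars <;> ring_nf <;> simp <;> norm_num
  rw [key]
  simp only [map_smul, map_add, map_sub, hsq]

theorem PauliString.isState_conj {A : Type*} [Fintype A] [DecidableEq A] (p : PauliString A)
    {σ : Op A} (hσ : IsState σ) : IsState (p.op * σ * p.op) := by
  constructor
  · simpa only [PauliString.conjTranspose_op] using hσ.1.mul_mul_conjTranspose_same p.op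
  · rw [Matrix.trace_mul_comm, ← mul_assoc, PauliString.op_mul_self, one_mul, hσ.2]

end Channels

section HaydenPreskill

theorem conjTranspose_reindex_mul_reindex {S T R : Type*} [Fintype S] [DecidableEq S] [Fintype T]
    [DecidableEq R] [Fintype R] (e : S ≃ T) (f : S ≃ R) {U : Matrix S S ℂ}
    (hU : U ∈ Matrix.unitaryGroup S ℂ) :
    (Matrix.reindex e f U)ᴴ * Matrix.reindex e f U = 1 := by
  have hUU : Uᴴ * U = 1 := Matrix.mem_unitaryGroup_iff'.1 hU
  simp [Matrix.reindex_apply, Matrix.conjTranspose_submatrix, Matrix.submatrix_mul_equiv, hUU]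

/-! ### Blocks of an operator along the discarded system -/

section Slice

variable {α γ δ β : Type*}

/-- The block `⟨c| G` of an operator into a three-part system. -/
def slice (G : Matrix ((γ × δ) × β) α ℂ) (c : γ) : Matrix (δ × β) α ℂ :=
  G.submatrix (fun x => ((c, x.1), x.2)) id

theorem slice_mul [Fintype α] {α' : Type*} (G : Matrix ((γ × δ) × β) α ℂ) (M : Matrix α α' ℂ)
    (c : γ) : slice (G * M) c = slice G c * M := rfl

variable [Fintype γ] [Fintype δ] [Fintype β] [DecidableEq β]

theorem slice_kronecker_mul (E : Matrix γ γ ℂ) (L : Matrix δ δ ℂ) (G : Matrix ((γ × δ) × β) α ℂ)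
    (c : γ) : slice (((E ⊗ₖ L) ⊗ₖ (1 : Matrix β β ℂ)) * G) c =
      ∑ c', E c c' • ((L ⊗ₖ (1 : Matrix β β ℂ)) * slice G c') := by
  ext ⟨d, b⟩ a
  simp [slice, Matrix.mul_apply, Matrix.sum_apply, Fintype.sum_prod_type, Matrix.one_apply,
    Finset.mul_sum, mul_assoc]

/-- Turns overlaps of the Kraus operators of `Tr_C` into compressions of the matrix units on `C`. -/
theorem conjTranspose_slice_mul_slice [DecidableEq γ] [DecidableEq δ]
    (G H : Matrix ((γ × δ) × β) α ℂ) (c c' : γ) : (slice G c)ᴴ * slice H c' =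
      Gᴴ * ((Matrix.single c c' (1 : ℂ) ⊗ₖ (1 : Matrix δ δ ℂ)) ⊗ₖ (1 : Matrix β β ℂ)) * H := by
  ext a a'
  simp [slice, Matrix.mul_apply, Fintype.sum_prod_type, Matrix.one_apply, Matrix.single_apply,
    ite_and]

/-- A unitary on the traced-out system drops out. -/
theorem sum_slice_kronecker_mul [Fintype α] [DecidableEq γ] {E : Matrix γ γ ℂ} (hE : Eᴴ * E = 1)
    (L : Matrix δ δ ℂ) (G : Matrix ((γ × δ) × β) α ℂ) (σ : Matrix α α ℂ) :
    ∑ c, slice (((E ⊗ₖ L) ⊗ₖ (1 : Matrix β β ℂ)) * G) c * σ *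
        (slice (((E ⊗ₖ L) ⊗ₖ (1 : Matrix β β ℂ)) * G) c)ᴴ =
      (L ⊗ₖ (1 : Matrix β β ℂ)) * (∑ c, slice G c * σ * (slice G c)ᴴ) *
        (L ⊗ₖ (1 : Matrix β β ℂ))ᴴ := by
  have hE' (x y : γ) : ∑ c, E c x * star (E c y) = if y = x then 1 else 0 := by
    have := congrFun (congrFun hE y) x
    simp only [Matrix.mul_apply, Matrix.conjTranspose_apply, Matrix.one_apply] at this
    simpa only [mul_comm] using this
  set F := L ⊗ₖ (1 : Matrix β β ℂ) with hF
  calc _ = ∑ c, ∑ y, ∑ x, (E c x * star (E c y)) • (F * (slice G x * σ * (slice G y)ᴴ) * Fᴴ) := by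
        refine Finset.sum_congr rfl fun c _ => ?_
        rw [slice_kronecker_mul, Matrix.conjTranspose_sum, Matrix.mul_sum]
        refine Finset.sum_congr rfl fun y _ => ?_
        rw [Matrix.sum_mul, Matrix.sum_mul]
        refine Finset.sum_congr rfl fun x _ => ?_
        simp only [Matrix.conjTranspose_smul, Matrix.conjTranspose_mul, Matrix.smul_mul,
          Matrix.mul_smul, smul_smul, Matrix.mul_assoc, mul_comm, hF]
    _ = ∑ y, ∑ x, (∑ c, E c x * star (E c y)) • (F * (slice G x * σ * (slice G y)ᴴ) * Fᴴ) := by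
        rw [Finset.sum_comm]
        refine Finset.sum_congr rfl fun y _ => ?_
        rw [Finset.sum_comm]
        simp_rw [Finset.sum_smul]
    _ = _ := by
        simp_rw [hE', ite_smul, one_smul, zero_smul]
        simp [Matrix.mul_sum, Matrix.sum_mul]

end Slice

/-! ### Compression by the EPR pair -/

section EPR

variable {A B : Type*} [Fintype A] [Fintype B] [DecidableEq A] [DecidableEq B]

theorem attachEPR_mul (M : Op A) :
    attachEPR A B * M = ((M ⊗ₖ (1 : Op B)) ⊗ₖ (1 : Op B)) * attachEPR A B := by
  ext ⟨⟨a, b⟩, b'⟩ a'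
  simp [attachEPR, Matrix.mul_apply, Fintype.sum_prod_type, Matrix.one_apply, mul_comm]

/-- The reduced state of the EPR pair on `B` is maximally mixed, so `N` enters only through its
normalized trace. -/
theorem conjTranspose_attachEPR_mul (M : Op A) (N : Op B) :
    (attachEPR A B)ᴴ * ((M ⊗ₖ N) ⊗ₖ (1 : Op B)) * attachEPR A B =
      (((2 : ℂ) ^ Fintype.card B)⁻¹ * N.trace) • M := by
  have hs : ((√(2 ^ Fintype.card B) : ℝ) : ℂ)⁻¹ * ((√(2 ^ Fintype.card B) : ℝ) : ℂ)⁻¹ =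
      ((2 : ℂ) ^ Fintype.card B)⁻¹ := by
    rw [← mul_inv, ← Complex.ofReal_mul, Real.mul_self_sqrt (by positivity)]
    push_cast
    rfl
  ext a a'
  simp only [attachEPR, epr, Matrix.mul_apply, Fintype.sum_prod_type]
  simp [Matrix.one_apply, Matrix.trace, apply_ite, ← hs, Finset.mul_sum, Finset.sum_mul]
  exact Finset.sum_congr rfl fun _ _ => by ring

end EPR

/-! ### The encoder, and recovery implies injectivity -/

variable {S A B C D : Type*} [Fintype S] [Fintype A] [Fintype B] [Fintype C] [Fintype D]
  [DecidableEq S] [DecidableEq A] [DecidableEq B] [DecidableEq C] [DecidableEq D]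

theorem noisyChannel_eq_sum_slice {S D : Type*} (eAB : A ⊕ B ≃ S) (eCD : C ⊕ D ≃ S) (U : Op S)
    (σ : Op A) : noisyChannel eAB eCD U σ =
      ∑ c, slice (encoder eAB eCD U) c * σ * (slice (encoder eAB eCD U) c)ᴴ := by
  ext x y
  simp [noisyChannel, slice, Matrix.sum_apply, Matrix.mul_apply]

/-- Sandwiching an operator on `C D` by the encoder. -/
theorem conjTranspose_encoder_mul {S : Type*} (eAB : A ⊕ B ≃ S) (eCD : C ⊕ D ≃ S) (U : Op S)
    (M : Matrix (Bits C × Bits D) (Bits C × Bits D) ℂ) :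
    (encoder eAB eCD U)ᴴ * (M ⊗ₖ (1 : Op B)) * encoder eAB eCD U =
      (attachEPR A B)ᴴ * (((Matrix.reindex (splitBits eCD) (splitBits eAB) U)ᴴ * M *
        Matrix.reindex (splitBits eCD) (splitBits eAB) U) ⊗ₖ (1 : Op B)) * attachEPR A B := by
  have h : ((Matrix.reindex (splitBits eCD) (splitBits eAB) U)ᴴ * M *
        Matrix.reindex (splitBits eCD) (splitBits eAB) U) ⊗ₖ (1 : Op B) =
      (Matrix.reindex (splitBits eCD) (splitBits eAB) U ⊗ₖ (1 : Op B))ᴴ * (M ⊗ₖ (1 : Op B)) *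
        (Matrix.reindex (splitBits eCD) (splitBits eAB) U ⊗ₖ (1 : Op B)) := by
    rw [Matrix.conjTranspose_kronecker, ← Matrix.mul_kronecker_mul, ← Matrix.mul_kronecker_mul]
    simp
  rw [h, encoder, Matrix.conjTranspose_mul]
  simp only [Matrix.mul_assoc]

theorem encoder_mul_pauli (eAB : A ⊕ B ≃ S) (eCD : C ⊕ D ≃ S) {U : Op S} (hU : IsClifford U)
    (p : PauliString A) : ∃ c : ℂ, ‖c‖ = 1 ∧ encoder eAB eCD U * p.op =
      c • ((((forwardMapC eAB eCD hU p).op ⊗ₖ (forwardMapD eAB eCD hU p).op) ⊗ₖ (1 : Op B)) *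
        encoder eAB eCD U) := by
  obtain ⟨c, hc, h⟩ := forwardMap_spec eAB eCD hU p
  have hV := conjTranspose_reindex_mul_reindex (splitBits eCD) (splitBits eAB) hU.1
  refine ⟨c, hc, ?_⟩
  rw [← Matrix.smul_mul, ← Matrix.smul_kronecker, ← h, encoder, Matrix.mul_assoc, attachEPR_mul,
    ← Matrix.mul_assoc, ← Matrix.mul_assoc, ← Matrix.mul_kronecker_mul, ← Matrix.mul_kronecker_mul,
    Matrix.mul_assoc _ _ᴴ, hV, Matrix.mul_one, Matrix.mul_one]

theorem noisyChannel_pauli_conj (eAB : A ⊕ B ≃ S) (eCD : C ⊕ D ≃ S) {U : Op S}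
    (hU : IsClifford U) (p : PauliString A) (σ : Op A) :
    noisyChannel eAB eCD U (p.op * σ * p.op) =
      ((forwardMapD eAB eCD hU p).op ⊗ₖ (1 : Op B)) * noisyChannel eAB eCD U σ *
        ((forwardMapD eAB eCD hU p).op ⊗ₖ (1 : Op B))ᴴ := by
  obtain ⟨c, hc, h⟩ := encoder_mul_pauli eAB eCD hU p
  have hcc : c * star c = 1 := by
    rw [Complex.star_def, Complex.mul_conj, Complex.normSq_eq_norm_sq, hc]; simp
  have hE : ((forwardMapC eAB eCD hU p).op)ᴴ * (forwardMapC eAB eCD hU p).op = 1 := by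
    rw [PauliString.conjTranspose_op, PauliString.op_mul_self]
  rw [noisyChannel_eq_sum_slice, noisyChannel_eq_sum_slice, ← sum_slice_kronecker_mul hE]
  refine Finset.sum_congr rfl fun x _ => ?_
  set G := encoder eAB eCD U
  set T := (((forwardMapC eAB eCD hU p).op ⊗ₖ (forwardMapD eAB eCD hU p).op) ⊗ₖ (1 : Op B)) * G
  calc slice G x * (p.op * σ * p.op) * (slice G x)ᴴ
      = slice (G * p.op) x * σ * (slice (G * p.op) x)ᴴ := by
        rw [slice_mul, Matrix.conjTranspose_mul, PauliString.conjTranspose_op]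
        simp only [Matrix.mul_assoc]
    _ = (c • slice T x) * σ * (c • slice T x)ᴴ := by rw [h]; rfl
    _ = _ := by
        rw [Matrix.conjTranspose_smul, Matrix.smul_mul, Matrix.smul_mul, Matrix.mul_smul, smul_smul,
          hcc, one_smul]

theorem PerfectRecovery.forwardMapD_injective {eAB : A ⊕ B ≃ S} {eCD : C ⊕ D ≃ S} {U : Op S}
    (hU : IsClifford U) (h : PerfectRecovery eAB eCD U) :
    Function.Injective (forwardMapD eAB eCD hU) := by
  intro p q hpq
  obtain ⟨R, -, hR⟩ := h
  have key : LinearMap.mulRight ℂ p.op ∘ₗ LinearMap.mulLeft ℂ p.op =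
      LinearMap.mulRight ℂ q.op ∘ₗ LinearMap.mulLeft ℂ q.op := by
    refine LinearMap.ext_isState fun σ hσ => ?_
    simp only [LinearMap.comp_apply, LinearMap.mulLeft_apply, LinearMap.mulRight_apply]
    rw [← hR _ (p.isState_conj hσ), ← hR _ (q.isState_conj hσ), noisyChannel_pauli_conj eAB eCD hU,
      noisyChannel_pauli_conj eAB eCD hU, hpq]
  exact PauliString.eq_of_conj_eq fun X => LinearMap.congr_fun key X

/-! ### Injectivity implies recovery -/

theorem PauliString.exists_eq_tensor {K L S : Type*} (e : K ⊕ L ≃ S) (r : PauliString S) :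
    ∃ p q, r = PauliString.tensor e p q := by
  refine ⟨fun k => r (e (Sum.inl k)), fun l => r (e (Sum.inr l)), funext fun s => ?_⟩
  obtain ⟨t, rfl⟩ := e.surjective s
  rcases t with t | t <;> simp [PauliString.tensor]

theorem PauliString.tensor_id {K L S : Type*} (e : K ⊕ L ≃ S) :
    PauliString.tensor e (PauliString.id K) (PauliString.id L) = PauliString.id S := by
  funext s
  obtain ⟨t, rfl⟩ := e.surjective s
  rcases t with t | t <;> simp [PauliString.tensor, PauliString.id]

/-- If `Λ_D` is injective, no nonidentity Pauli operator on `C` has a component within the code space. -/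
theorem conjTranspose_encoder_mul_pauli (eAB : A ⊕ B ≃ S) (eCD : C ⊕ D ≃ S) {U : Op S}
    (hU : IsClifford U) (hinj : Function.Injective (forwardMapD eAB eCD hU)) {r : PauliString C}
    (hr : r ≠ PauliString.id C) :
    (encoder eAB eCD U)ᴴ * ((r.op ⊗ₖ (1 : Op D)) ⊗ₖ (1 : Op B)) * encoder eAB eCD U = 0 := by
  obtain ⟨t, ht⟩ := (evolve_bijective hU).2 (PauliString.tensor eCD r (PauliString.id D))
  obtain ⟨p, q, rfl⟩ := PauliString.exists_eq_tensor eAB t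
  -- If `q` were trivial, `Λ_D(p)` would be the identity string, as is `Λ_D(id)`; injectivity gives
  -- `p = id`, hence `r = id`.
  have hq : q ≠ PauliString.id B := by
    rintro rfl
    have hp : p = PauliString.id A := by
      apply hinj
      funext d
      simp only [forwardMapD, ht, PauliString.tensor_id, evolve_id]
      simp [PauliString.tensor, PauliString.id]
    rw [hp, PauliString.tensor_id, evolve_id] at ht
    apply hr
    funext c
    simpa [PauliString.tensor, PauliString.id] using (congrFun ht (eCD (Sum.inl c))).symm
  obtain ⟨c, hc, h⟩ := evolve_spec hU (PauliString.tensor eAB p q)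
  rw [ht] at h
  have hc0 : c ≠ 0 := by rintro rfl; simp at hc
  have hV := conjTranspose_reindex_mul_reindex (splitBits eCD) (splitBits eAB) hU.1
  set V := Matrix.reindex (splitBits eCD) (splitBits eAB) U with hVdef
  have h2 : V * (p.op ⊗ₖ q.op) * Vᴴ = c • (r.op ⊗ₖ (1 : Op D)) := by
    rw [← PauliString.op_id, ← PauliString.op_tensor eCD, ← PauliString.op_tensor eAB]
    refine Eq.trans ?_ (congrArg (Matrix.reindex (splitBits eCD) (splitBits eCD)) h)
    simp [hVdef, Matrix.reindex_apply, Matrix.submatrix_mul_equiv, Matrix.conjTranspose_submatrix]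
  have h3 : Vᴴ * (r.op ⊗ₖ (1 : Op D)) * V = c⁻¹ • (p.op ⊗ₖ q.op) := by
    rw [eq_inv_smul_iff₀ hc0, ← Matrix.smul_mul, ← Matrix.mul_smul, ← h2]
    simp only [Matrix.mul_assoc, hV, Matrix.mul_one]
    rw [← Matrix.mul_assoc, hV, Matrix.one_mul]
  rw [conjTranspose_encoder_mul, h3, Matrix.smul_kronecker, Matrix.mul_smul, Matrix.smul_mul,
    conjTranspose_attachEPR_mul, PauliString.trace_op_of_ne hq]
  simp

theorem conjTranspose_encoder_mul_self (eAB : A ⊕ B ≃ S) (eCD : C ⊕ D ≃ S) {U : Op S}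
    (hU : U ∈ Matrix.unitaryGroup (Bits S) ℂ) :
    (encoder eAB eCD U)ᴴ * encoder eAB eCD U = 1 := by
  have h := conjTranspose_encoder_mul eAB eCD U 1
  rw [Matrix.mul_one, conjTranspose_reindex_mul_reindex _ _ hU, ← Matrix.one_kronecker_one (m := Bits A),
    conjTranspose_attachEPR_mul] at h
  simpa using h

/-- Operators on `C` act trivially within the code space: `Γ† E_C Γ = Tr(E) / d_C`. -/
theorem two_pow_smul_conjTranspose_encoder_mul (eAB : A ⊕ B ≃ S) (eCD : C ⊕ D ≃ S) {U : Op S}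
    (hU : IsClifford U) (hinj : Function.Injective (forwardMapD eAB eCD hU)) (E : Op C) :
    (2 : ℂ) ^ Fintype.card C •
        ((encoder eAB eCD U)ᴴ * ((E ⊗ₖ (1 : Op D)) ⊗ₖ (1 : Op B)) * encoder eAB eCD U) =
      E.trace • 1 := by
  let f : Op C →ₗ[ℂ] Op A :=
    { toFun := fun E =>
        (encoder eAB eCD U)ᴴ * ((E ⊗ₖ (1 : Op D)) ⊗ₖ (1 : Op B)) * encoder eAB eCD U
      map_add' := fun X Y => by simp [Matrix.add_kronecker, Matrix.mul_add, Matrix.add_mul]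
      map_smul' := fun c X => by simp [Matrix.smul_kronecker] }
  have h1 : f 1 = 1 := by simp [f, conjTranspose_encoder_mul_self eAB eCD hU.1]
  have := LinearMap.eq_trace_smul_of_pauli f
    (fun p hp => conjTranspose_encoder_mul_pauli eAB eCD hU hinj hp) E
  rwa [h1] at this

theorem perfectRecovery_of_forwardMapD_injective (eAB : A ⊕ B ≃ S) (eCD : C ⊕ D ≃ S) {U : Op S}
    (hU : IsClifford U) (hinj : Function.Injective (forwardMapD eAB eCD hU)) :
    PerfectRecovery eAB eCD U := by
  set G := encoder eAB eCD U with hG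
  set s : ℂ := ((√(2 ^ Fintype.card C) : ℝ) : ℂ) with hs
  have hss : s * s = 2 ^ Fintype.card C := by
    rw [hs, ← Complex.ofReal_mul, Real.mul_self_sqrt (by positivity)]
    push_cast
    rfl
  have hstar : star s = s := Complex.conj_ofReal _
  have hpow : (2 : ℂ) ^ Fintype.card C ≠ 0 := by positivity
  -- Each block satisfies `K† K = 1 / d_C`, so scaling by `√d_C` makes it an isometry.
  obtain ⟨R, hR, hRK⟩ := exists_recovery_of_orthogonal_isometries (fun c => s • slice G c) (by
    intro c c'
    rw [Matrix.conjTranspose_smul, Matrix.smul_mul, Matrix.mul_smul, smul_smul, hstar, hss,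
      conjTranspose_slice_mul_slice, hG, two_pow_smul_conjTranspose_encoder_mul eAB eCD hU hinj]
    by_cases h : c = c'
    · simp [h]
    · simp [h])
  have hRK' (c : Bits C) (σ : Op A) :
      R (slice G c * σ * (slice G c)ᴴ) = ((2 : ℂ) ^ Fintype.card C)⁻¹ • σ := by
    rw [eq_inv_smul_iff₀ hpow, ← map_smul, ← hss]
    refine Eq.trans (congrArg R ?_) (hRK c σ)
    rw [Matrix.conjTranspose_smul, Matrix.smul_mul, Matrix.smul_mul, Matrix.mul_smul, smul_smul,
      hstar]
  refine ⟨R, hR, fun σ _ => ?_⟩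
  -- Each of the `d_C` blocks returns `σ / d_C`.
  rw [noisyChannel_eq_sum_slice, map_sum, Finset.sum_congr rfl fun c _ => hRK' c σ,
    Finset.sum_const, Finset.card_univ, ← Nat.cast_smul_eq_nsmul ℂ, smul_smul]
  simp

end HaydenPreskill

end

theorem mainTheorem1 {S A B C D : Type*}
    [Fintype S] [Fintype A] [Fintype B] [Fintype C] [Fintype D]
    [DecidableEq S] [DecidableEq A] [DecidableEq B] [DecidableEq C] [DecidableEq D]
    (eAB : A ⊕ B ≃ S) (eCD : C ⊕ D ≃ S) (U : Op S) (hU : IsClifford U) :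
    PerfectRecovery eAB eCD U ↔ Function.Injective (forwardMapD eAB eCD hU) :=
  ⟨fun h => h.forwardMapD_injective hU, perfectRecovery_of_forwardMapD_injective eAB eCD hU⟩
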